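/- Let $E$ and $F$ be Banach spaces over $\mathbb K=\mathbb R$ or $\mathbb C$, and let $B(E,F)$ be the Banach space of bounded linear operators from $E$ to $F$. For $T\in B(E,F)$ write $N(T)$ for the kernel and $R(T)$ for the range of $T$; $\operatorname{codim}R(T)=\dim F/R(T)$. Call $T$ *double splitting* if $R(T)$ is closed and $N(T)$ and $R(T)$ have closed complements in $E$ and $F$ respectively, and *semi-Fredholm* if $R(T)$ is closed and $N(T)$ is finite-dimensional or $R(T)$ has finite codimension. For integers $k,m,n\ge 0$ let - $F_k=\{T\in B(E,F):\operatorname{rank}T=k\}$; - $\Phi_{m,n}=\{T\in B(E,F):\dim N(T)=m,\ \operatorname{codim}R(T)=n\}$; - $\Phi_{m,\infty}$ be the set of double splitting semi-Fredholm operators $T\in B(E,F)$ with $\dim N(T)=m$ and $\operatorname{codim}R(T)=\infty$; - $\Phi_{\infty,n}$ be the set of double splitting semi-Fredholm operators $T\in B(E,F)$ with $\dim N(T)=\infty$ and $\operatorname{codim}R(T)=n$. For $X\in B(E,F)$ put $M(X)=\{T\in B(E,F): T\,N(X)\subset R(X)\}$. A subset $S$ of a Banach space $G$ is a *smooth submanifold*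 of $G$ if for every $x\in S$ there are a decomposition $G=E_0\oplus E_1$ into closed subspaces and a $C^\infty$ diffeomorphism $\varphi$ from an open neighbourhood $U$ of $x$ in $G$ onto an open set $\varphi(U)\subset G$ such that $\varphi(S\cap U)=E_0\cap\varphi(U)$. The *tangent space* of $S$ at $x\in S$ is the set of all $\dot c(0)$, where $c:(-\varepsilon,\varepsilon)\to G$ ($\varepsilon>0$, real parameter) is a $C^1$ curve contained in $S$ with $c(0)=x$. **Theorem 4.2.** Let $S$ be any one of the classes $F_k$, $\Phi_{m,n}$, $\Phi_{m,\infty}$, $\Phi_{\infty,n}$ with $k,m,n\ge 0$ finite. Then $S$ is a smooth submanifold of $B(E,F)$, and for every $X\in S$ the tangent space of $S$ at $X$ is $M(X)$. -/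

import Mathlib

open scoped ContDiff

namespace OperatorClasses

section Submanifold

variable (𝕜 : Type*) [RCLike 𝕜] {G : Type*} [NormedAddCommGroup G] [NormedSpace 𝕜 G]

/-- `S` is a smooth (split) submanifold of the Banach space `G`: around each of its points there is
a smooth diffeomorphism `φ` between open subsets of `G` that carries the part of `S` in the domain
of `φ` onto an open subset of a closed complemented subspace `E₀` of `G`. The subspace may depend
on the point. -/
def IsSmoothSubmanifold (S : Set G) : Prop :=
  ∀ x ∈ S, ∃ (E₀ E₁ : Submodule 𝕜 G) (φ : OpenPartialHomeomorph G G),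
    IsClosed (E₀ : Set G) ∧ IsClosed (E₁ : Set G) ∧ IsCompl E₀ E₁ ∧
    x ∈ φ.source ∧
    ContDiffOn 𝕜 ∞ φ φ.source ∧ ContDiffOn 𝕜 ∞ φ.symm φ.target ∧
    φ '' (S ∩ φ.source) = (E₀ : Set G) ∩ φ.target

/-- The tangent space of `S` at `x`: the set of all velocities `c'(0)` of `C¹` curves
`c : (-ε, ε) → G` (with a real parameter) that lie in `S` and satisfy `c 0 = x`. -/
def tangentVectors (S : Set G) (x : G) : Set G :=
  letI : NormedSpace ℝ G := NormedSpace.restrictScalars ℝ 𝕜 G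
  {v | ∃ (ε : ℝ) (c : ℝ → G), 0 < ε ∧ ContDiffOn ℝ 1 c (Set.Ioo (-ε) ε) ∧
    (∀ t ∈ Set.Ioo (-ε) ε, c t ∈ S) ∧ c 0 = x ∧ HasDerivAt c v 0}

end Submanifold

section Operators

variable {𝕜 : Type*} [RCLike 𝕜] {E F : Type*}
  [NormedAddCommGroup E] [NormedSpace 𝕜 E] [NormedAddCommGroup F] [NormedSpace 𝕜 F]

/-- `A` is double splitting: its range is closed, and its kernel and its range have closed
complements. -/
def IsDoubleSplitting (A : E →L[𝕜] F) : Prop :=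
  IsClosed (A.range : Set F) ∧
  (∃ R' : Submodule 𝕜 E, IsClosed (R' : Set E) ∧ IsCompl A.ker R') ∧
  (∃ N' : Submodule 𝕜 F, IsClosed (N' : Set F) ∧ IsCompl A.range N')

/-- `A` is semi-Fredholm: its range is closed, and its kernel is finite-dimensional or its range
has finite codimension. -/
def IsSemiFredholm (A : E →L[𝕜] F) : Prop :=
  IsClosed (A.range : Set F) ∧
  (FiniteDimensional 𝕜 A.ker ∨ FiniteDimensional 𝕜 (F ⧸ A.range))

variable (𝕜 E F)

/-- `F_k`: the bounded operators of rank `k`. -/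
def rankClass (k : ℕ) : Set (E →L[𝕜] F) :=
  {T | Module.rank 𝕜 T.range = k}

/-- `Φ_{m,n}`: the bounded operators with `dim N(T) = m` and `codim R(T) = n`, both finite. -/
def PhiFinFin (m n : ℕ) : Set (E →L[𝕜] F) :=
  {T | Module.rank 𝕜 T.ker = m ∧ Module.rank 𝕜 (F ⧸ T.range) = n}

/-- `Φ_{m,∞}`: the double splitting semi-Fredholm operators with `dim N(T) = m` finite and
`codim R(T) = ∞`. -/
def PhiFinInf (m : ℕ) : Set (E →L[𝕜] F) :=
  {T | IsSemiFredholm T ∧ IsDoubleSplitting T ∧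
    Module.rank 𝕜 T.ker = m ∧ ¬ FiniteDimensional 𝕜 (F ⧸ T.range)}

/-- `Φ_{∞,n}`: the double splitting semi-Fredholm operators with `dim N(T) = ∞` and
`codim R(T) = n` finite. -/
def PhiInfFin (n : ℕ) : Set (E →L[𝕜] F) :=
  {T | IsSemiFredholm T ∧ IsDoubleSplitting T ∧
    ¬ FiniteDimensional 𝕜 T.ker ∧ Module.rank 𝕜 (F ⧸ T.range) = n}

variable {𝕜 E F}

/-- `M(X) = {T : T N(X) ⊂ R(X)}`, a linear subspace of `B(E, F)`. -/
def M (X : E →L[𝕜] F) : Submodule 𝕜 (E →L[𝕜] F) where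
  carrier := {T | ∀ x ∈ X.ker, T x ∈ X.range}
  zero_mem' := fun _ _ => X.range.zero_mem
  add_mem' := fun hS hT x hx => X.range.add_mem (hS x hx) (hT x hx)
  smul_mem' := fun a _ hT x hx => X.range.smul_mem a (hT x hx)

/-- `S` is a smooth submanifold of `B(E, F)` which is tangent to `M(X)` at each `X ∈ S`, that is,
its tangent space at `X` is `M(X)`. -/
def IsSmoothSubmanifoldTangentToM (S : Set (E →L[𝕜] F)) : Prop :=
  IsSmoothSubmanifold 𝕜 S ∧
    ∀ X ∈ S, tangentVectors 𝕜 S X = (M X : Set (E →L[𝕜] F))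

end Operators

end OperatorClasses

/-!
Let `Y` be a generalized inverse of `X ∈ S`. For `T` near `X` the operator `1 + (T - X) Y` is
invertible, and eliminating blocks with it shows that `T` is equivalent to `X + W`, where `W` is an
operator from `X.ker` to `Y.ker` (a Schur complement). The kernel of `X + W` is contained in that of
`X`, and its range contains that of `X`; since the dimensions in each of the four classes leave no
room for both to change strictly, `X + W` lies in `S` only if `W = 0`. There is a chart around `X`
in which `W` is the block of the image of `T` from `X.ker` to `Y.ker`, so that this chart maps `S`
to the kernel of a block projection, which is `M X`. It fixes `X`, and its derivative there is the
identity, so the tangent space of `S` at `X` is `M X` as well.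
-/

namespace OperatorClasses

open Submodule Topology

section Chart

theorem mem_of_hasDerivAt_of_eventually_mem {G : Type*} [NormedAddCommGroup G] [NormedSpace ℝ G]
    {p : Submodule ℝ G} (hp : IsClosed (p : Set G)) {c : ℝ → G} {v : G} {t₀ : ℝ}
    (hv : HasDerivAt c v t₀) (hc : ∀ᶠ t in 𝓝 t₀, c t ∈ p) : v ∈ p := by
  refine hp.mem_of_tendsto hv.tendsto_slope ?_
  filter_upwards [nhdsWithin_le_nhds hc] with t ht
  exact p.smul_mem _ (p.sub_mem ht hc.self_of_nhds)

variable {𝕜 : Type*} [RCLike 𝕜] {G : Type*} [NormedAddCommGroup G] [NormedSpace 𝕜 G]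

theorem tangentVectors_eq_image_of_isImage {S : Set G} {p : Submodule 𝕜 G}
    (hp : IsClosed (p : Set G)) {φ : OpenPartialHomeomorph G G} (hφ : φ.IsImage S p)
    (hsmooth : ContDiffOn 𝕜 1 φ.symm φ.target) {x : G} (hxφ : x ∈ φ.source) (hxS : x ∈ S)
    {f : G ≃L[𝕜] G} (hf : HasFDerivAt φ.symm (f : G →L[𝕜] G) (φ x)) :
    tangentVectors 𝕜 S x = f '' p := by
  let : NormedSpace ℝ G := NormedSpace.restrictScalars ℝ 𝕜 G
  have : IsScalarTower ℝ 𝕜 G := .of_algebraMap_smul fun _ _ => rfl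
  have hφx : φ x ∈ p := (hφ.apply_mem_iff hxφ).2 hxS
  apply Set.Subset.antisymm
  · rintro v ⟨ε, c, hε, -, hcS, rfl, hv⟩
    have hφ' : HasFDerivAt φ (f.symm : G →L[𝕜] G) (c 0) :=
      φ.symm.hasFDerivAt_symm hxφ hf
    have hφc : HasDerivAt (φ ∘ c) (f.symm v) 0 :=
      (hφ'.restrictScalars ℝ).comp_hasDerivAt 0 hv
    have hmem : ∀ᶠ t in 𝓝 0, (φ ∘ c) t ∈ p.restrictScalars ℝ := by
      filter_upwards [hv.continuousAt (φ.open_source.mem_nhds hxφ),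
        Ioo_mem_nhds (neg_lt_zero.2 hε) hε] with t htφ ht
      exact (hφ.apply_mem_iff htφ).2 (hcS t ht)
    exact ⟨f.symm v, mem_of_hasDerivAt_of_eventually_mem (p := p.restrictScalars ℝ) hp hφc hmem,
      f.apply_symm_apply v⟩
  · rintro _ ⟨w, hw, rfl⟩
    let line : ℝ → G := fun t => φ x + t • w
    have hline : ContDiff ℝ 1 line := by fun_prop
    have hline' : HasDerivAt line w 0 := by
      simpa [line] using ((hasDerivAt_id (0 : ℝ)).smul_const w).const_add (φ x)
    have hline0 : line 0 = φ x := by simp [line]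
    have htarget : ∀ᶠ t in 𝓝 0, line t ∈ φ.target :=
      hline.continuous.continuousAt (φ.open_target.mem_nhds (hline0 ▸ φ.map_source hxφ))
    obtain ⟨ε, hε, hball⟩ := Metric.eventually_nhds_iff_ball.1 htarget
    rw [Real.ball_zero_eq_Ioo] at hball
    refine ⟨ε, φ.symm ∘ line, hε, (hsmooth.restrict_scalars ℝ).comp hline.contDiffOn hball,
      fun t ht => ?_, ?_, ?_⟩
    · exact (hφ.symm_apply_mem_iff (hball t ht)).2
        (p.add_mem hφx ((p.restrictScalars ℝ).smul_mem t hw))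
    · rw [Function.comp_apply, hline0, φ.left_inv hxφ]
    · exact (hf.restrictScalars ℝ).comp_hasDerivAt_of_eq 0 hline' hline0.symm

end Chart

section GeneralizedInverse

variable {𝕜 : Type*} [NontriviallyNormedField 𝕜] {E F : Type*}
  [NormedAddCommGroup E] [NormedSpace 𝕜 E] [NormedAddCommGroup F] [NormedSpace 𝕜 F]

/-- `Y` is a (reflexive) generalized inverse of `X`, that is, `X Y X = X` and `Y X Y = Y`. The
operators `X Y` and `Y X` are then projections, onto `X.range` along `Y.ker` and onto `Y.range`
along `X.ker`. -/
structure IsGeneralizedInverse (X : E →L[𝕜] F) (Y : F →L[𝕜] E) : Prop where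
  apply_left : ∀ x, X (Y (X x)) = X x
  apply_right : ∀ y, Y (X (Y y)) = Y y

namespace IsGeneralizedInverse

variable {X : E →L[𝕜] F} {Y : F →L[𝕜] E}

theorem symm (H : IsGeneralizedInverse X Y) : IsGeneralizedInverse Y X :=
  ⟨H.apply_right, H.apply_left⟩

theorem isTopCompl_range_ker (H : IsGeneralizedInverse X Y) : IsTopCompl X.range Y.ker := by
  have hrange : (X ∘L Y).range = X.range :=
    le_antisymm (LinearMap.range_comp_le_range _ _) fun _ ⟨x, hx⟩ => ⟨X x, hx ▸ H.apply_left x⟩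
  have hker : (X ∘L Y).ker = Y.ker := by
    refine le_antisymm (fun y hy => ?_) (LinearMap.ker_le_ker_comp _ _)
    have hXY : X (Y y) = 0 := hy
    simpa [hXY] using (H.apply_right y).symm
  have hidem : IsIdempotentElem (X ∘L Y) := by
    ext y
    simp [H.apply_left]
  exact hrange ▸ hker ▸ ContinuousLinearMap.IsIdempotentElem.isTopCompl hidem

end IsGeneralizedInverse

theorem exists_isGeneralizedInverse [CompleteSpace E] [CompleteSpace F] {X : E →L[𝕜] F}
    {R : Submodule 𝕜 E} (hRc : IsClosed (R : Set E)) (hR : IsCompl X.ker R)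
    {N : Submodule 𝕜 F} (hNc : IsClosed (N : Set F)) (hN : IsCompl X.range N) :
    ∃ Y, IsGeneralizedInverse X Y := by
  have := hRc.completeSpace_coe
  have := hNc.completeSpace_coe
  let XR : R →L[𝕜] F := X ∘L R.subtypeL
  have hker : XR.ker = ⊥ := LinearMap.ker_eq_bot'.2 fun u hu =>
    Subtype.ext (disjoint_def.1 hR.disjoint u hu u.2)
  have hXR : ∀ x, ∃ u, XR u = X x := fun x => by
    obtain ⟨a, ha, b, hb, rfl⟩ := mem_sup.1 (hR.sup_eq_top ▸ mem_top (x := x))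
    exact ⟨⟨b, hb⟩, by simpa [XR] using ha⟩
  have hrange : XR.range = X.range :=
    le_antisymm (LinearMap.range_comp_le_range _ _) fun _ ⟨x, hx⟩ => hx ▸ hXR x
  let e : (R × N) ≃L[𝕜] F := XR.coprodSubtypeLEquivOfIsCompl (hrange ▸ hN) hker
  have he : ∀ u, e.symm (XR u) = (u, 0) := fun u => by
    rw [e.symm_apply_eq]
    simp [e, ContinuousLinearMap.coprodSubtypeLEquivOfIsCompl]
  refine ⟨R.subtypeL ∘L ContinuousLinearMap.fst 𝕜 R N ∘L (e.symm : F →L[𝕜] R × N),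
    fun x => ?_, fun y => ?_⟩
  · obtain ⟨u, hu⟩ := hXR x
    change XR (e.symm (X x)).1 = X x
    rw [← hu, he]
  · change ((e.symm (XR (e.symm y).1)).1 : E) = (e.symm y).1
    rw [he]

end GeneralizedInverse

section AreEquivalent

variable {𝕜 : Type*} [NontriviallyNormedField 𝕜] {E F : Type*}
  [NormedAddCommGroup E] [NormedSpace 𝕜 E] [NormedAddCommGroup F] [NormedSpace 𝕜 F]

/-- `T` and `T'` are equivalent: they differ by automorphisms of the source and the target. -/
def AreEquivalent (T T' : E →L[𝕜] F) : Prop :=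
  ∃ (A : F ≃L[𝕜] F) (B : E ≃L[𝕜] E), T' = (A : F →L[𝕜] F) ∘L T ∘L (B : E →L[𝕜] E)

namespace AreEquivalent

variable {T T' : E →L[𝕜] F}

theorem symm (h : AreEquivalent T T') : AreEquivalent T' T := by
  obtain ⟨A, B, rfl⟩ := h
  exact ⟨A.symm, B.symm, by ext; simp⟩

theorem rank_ker_eq (h : AreEquivalent T T') :
    Module.rank 𝕜 T.ker = Module.rank 𝕜 T'.ker := by
  obtain ⟨A, B, rfl⟩ := h
  have hker : ((A : F →L[𝕜] F) ∘L T ∘L (B : E →L[𝕜] E)).ker =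
      T.ker.comap (B.toLinearEquiv : E →ₗ[𝕜] E) := by
    ext x
    simp
  rw [hker]
  exact (B.toLinearEquiv.ofSubmodule' T.ker).symm.rank_eq

theorem map_range_eq (A : F ≃L[𝕜] F) (B : E ≃L[𝕜] E) (T : E →L[𝕜] F) :
    T.range.map (A.toLinearEquiv : F →ₗ[𝕜] F) =
      ((A : F →L[𝕜] F) ∘L T ∘L (B : E →L[𝕜] E)).range := by
  ext y
  constructor
  · rintro ⟨_, ⟨x, rfl⟩, rfl⟩
    exact ⟨B.symm x, by simp⟩
  · rintro ⟨x, rfl⟩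
    exact ⟨T (B x), ⟨B x, rfl⟩, rfl⟩

theorem rank_range_eq (h : AreEquivalent T T') :
    Module.rank 𝕜 T.range = Module.rank 𝕜 T'.range := by
  obtain ⟨A, B, rfl⟩ := h
  rw [← map_range_eq]
  exact (A.toLinearEquiv.submoduleMap T.range).rank_eq

theorem rank_quotient_range_eq (h : AreEquivalent T T') :
    Module.rank 𝕜 (F ⧸ T.range) = Module.rank 𝕜 (F ⧸ T'.range) := by
  obtain ⟨A, B, rfl⟩ := h
  exact (Quotient.equiv _ _ A.toLinearEquiv (map_range_eq A B T)).rank_eq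

theorem exists_isGeneralizedInverse (h : AreEquivalent T T') {Y : F →L[𝕜] E}
    (H : IsGeneralizedInverse T Y) : ∃ Y', IsGeneralizedInverse T' Y' := by
  obtain ⟨A, B, rfl⟩ := h
  exact ⟨(B.symm : E →L[𝕜] E) ∘L Y ∘L (A.symm : F →L[𝕜] F),
    fun x => by simp [H.apply_left], fun y => by simp [H.apply_right]⟩

end AreEquivalent

end AreEquivalent

section Corner

variable {𝕜 : Type*} [NontriviallyNormedField 𝕜] {E F : Type*}
  [NormedAddCommGroup E] [NormedSpace 𝕜 E] [NormedAddCommGroup F] [NormedSpace 𝕜 F]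

/-- The operator `1 - Y X`. If `Y` is a generalized inverse of `X`, it is the projection onto
`X.ker` along `Y.range`; with the roles of `X` and `Y` exchanged, the projection `1 - X Y` onto
`Y.ker` along `X.range`. -/
def kerProj (X : E →L[𝕜] F) (Y : F →L[𝕜] E) : E →L[𝕜] E :=
  1 - Y ∘L X

@[simp]
theorem kerProj_apply (X : E →L[𝕜] F) (Y : F →L[𝕜] E) (x : E) : kerProj X Y x = x - Y (X x) :=
  rfl

/-- The compression `T ↦ (1 - X Y) T (1 - Y X)`: the block of `T` from `X.ker` to `Y.ker` with
respect to the decompositions `E = Y.range ⊕ X.ker` and `F = X.range ⊕ Y.ker`. -/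
noncomputable def corner (X : E →L[𝕜] F) (Y : F →L[𝕜] E) : (E →L[𝕜] F) →L[𝕜] (E →L[𝕜] F) :=
  (kerProj Y X).postcomp E ∘L (kerProj X Y).precomp F

@[simp]
theorem corner_apply_apply (X : E →L[𝕜] F) (Y : F →L[𝕜] E) (T : E →L[𝕜] F) (x : E) :
    corner X Y T x = kerProj Y X (T (kerProj X Y x)) :=
  rfl

namespace IsGeneralizedInverse

variable {X : E →L[𝕜] F} {Y : F →L[𝕜] E}

theorem isIdempotentElem_corner (H : IsGeneralizedInverse X Y) :
    IsIdempotentElem (corner X Y) := by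
  ext T x
  simp [H.apply_left, H.apply_right]

theorem ker_add_corner_le (H : IsGeneralizedInverse X Y) (T : E →L[𝕜] F) :
    (X + corner X Y T).ker ≤ X.ker := fun x hx => by
  have h : X (Y ((X + corner X Y T) x)) = X x := by simp [H.apply_left, H.apply_right]
  have hx' : (X + corner X Y T) x = 0 := hx
  simpa [hx'] using h.symm

theorem range_le_range_add_corner (H : IsGeneralizedInverse X Y) (T : E →L[𝕜] F) :
    X.range ≤ (X + corner X Y T).range := by
  rintro _ ⟨x, rfl⟩
  exact ⟨Y (X x), by simp [H.apply_left]⟩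

theorem corner_eq_zero_of_ker_add_corner_eq (H : IsGeneralizedInverse X Y) {T : E →L[𝕜] F}
    (h : (X + corner X Y T).ker = X.ker) : corner X Y T = 0 := by
  ext x
  have hker : kerProj X Y x ∈ (X + corner X Y T).ker := h ▸ by simp [H.apply_left]
  simpa [H.apply_left, H.apply_right] using hker

theorem corner_eq_zero_of_range_add_corner_eq (H : IsGeneralizedInverse X Y) {T : E →L[𝕜] F}
    (h : (X + corner X Y T).range = X.range) : corner X Y T = 0 := by
  ext x
  obtain ⟨z, hz⟩ : (X + corner X Y T) x ∈ X.range := h ▸ ⟨x, rfl⟩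
  have hXz : kerProj Y X (X z) = 0 := by simp [H.apply_left]
  have hz' : X z = (X + corner X Y T) x := hz
  rw [hz'] at hXz
  simpa [H.apply_left, H.apply_right] using hXz

end IsGeneralizedInverse

/-- Block elimination: `X + W = (X + corner X Y W) (1 + Y W)`, where `Y W` has square zero. -/
theorem areEquivalent_add_corner {X : E →L[𝕜] F} {Y : F →L[𝕜] E} {W : E →L[𝕜] F}
    (hW : W ∘L Y = 0) : AreEquivalent (X + corner X Y W) (X + W) := by
  have hWY : ∀ y, W (Y y) = 0 := DFunLike.congr_fun hW
  let B : E ≃L[𝕜] E := .equivOfInverse (1 + Y ∘L W) (1 - Y ∘L W)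
    (fun x => by simp [hWY]) (fun x => by simp [hWY])
  have hB : ∀ x, B x = x + Y (W x) := fun _ => rfl
  refine ⟨.refl 𝕜 F, B, ?_⟩
  ext x
  simp [hB, hWY]

end Corner

section Straightening

variable {𝕜 : Type*} [NontriviallyNormedField 𝕜] {E F : Type*}
  [NormedAddCommGroup E] [NormedSpace 𝕜 E] [NormedAddCommGroup F] [NormedSpace 𝕜 F]

/-- The operator `1 + (T - X) Y` on `F`. If `Y` is a generalized inverse of `X`, it carries `X x`
to `T x` for `x ∈ Y.range` and fixes `Y.ker`. -/
def transfer (X : E →L[𝕜] F) (Y : F →L[𝕜] E) (T : E →L[𝕜] F) : F →L[𝕜] F :=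
  1 + (T - X) ∘L Y

/-- The operator that agrees with `T` on `Y.range` and with `C T` on `X.ker`. The chart at `X` and
its inverse are both of this form. -/
def twist (X : E →L[𝕜] F) (Y : F →L[𝕜] E) (C : F →L[𝕜] F) (T : E →L[𝕜] F) : E →L[𝕜] F :=
  T ∘L Y ∘L X + C ∘L T ∘L kerProj X Y

@[simp]
theorem transfer_apply (X : E →L[𝕜] F) (Y : F →L[𝕜] E) (T : E →L[𝕜] F) (y : F) :
    transfer X Y T y = y + (T (Y y) - X (Y y)) :=
  rfl

@[simp]
theorem twist_apply (X : E →L[𝕜] F) (Y : F →L[𝕜] E) (C : F →L[𝕜] F) (T : E →L[𝕜] F) (x : E) :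
    twist X Y C T x = T (Y (X x)) + C (T (kerProj X Y x)) :=
  rfl

@[simp]
theorem transfer_self (X : E →L[𝕜] F) (Y : F →L[𝕜] E) : transfer X Y X = 1 := by
  simp [transfer]

@[simp]
theorem twist_one (X : E →L[𝕜] F) (Y : F →L[𝕜] E) (T : E →L[𝕜] F) : twist X Y 1 T = T := by
  ext x
  simp

theorem contDiff_transfer (X : E →L[𝕜] F) (Y : F →L[𝕜] E) {n : WithTop ℕ∞} :
    ContDiff 𝕜 n (transfer X Y) :=
  contDiff_const.add ((contDiff_id.sub contDiff_const).clm_comp contDiff_const)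

theorem contDiff_twist (X : E →L[𝕜] F) (Y : F →L[𝕜] E) {n : WithTop ℕ∞} :
    ContDiff 𝕜 n fun p : (F →L[𝕜] F) × (E →L[𝕜] F) => twist X Y p.1 p.2 :=
  (contDiff_snd.clm_comp contDiff_const).add
    (contDiff_fst.clm_comp (contDiff_snd.clm_comp contDiff_const))

theorem isOpen_isUnit_transfer [CompleteSpace F] (X : E →L[𝕜] F) (Y : F →L[𝕜] E) :
    IsOpen {T | IsUnit (transfer X Y T)} :=
  Units.isOpen.preimage (contDiff_transfer X Y (n := 0)).continuous

theorem contDiffOn_twist_inverse_transfer [CompleteSpace F] (X : E →L[𝕜] F) (Y : F →L[𝕜] E)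
    {n : WithTop ℕ∞} :
    ContDiffOn 𝕜 n (fun T => twist X Y (Ring.inverse (transfer X Y T)) T)
      {T | IsUnit (transfer X Y T)} := by
  rintro T ⟨A, hA⟩
  have hinv : ContDiffAt 𝕜 n (fun T => Ring.inverse (transfer X Y T)) T :=
    ContDiffAt.comp (g := Ring.inverse) T (hA ▸ contDiffAt_ringInverse 𝕜 A)
      (contDiff_transfer X Y).contDiffAt
  exact ((contDiff_twist X Y).contDiffAt.comp T (hinv.prodMk contDiffAt_id)).contDiffWithinAt

theorem contDiff_twist_transfer (X : E →L[𝕜] F) (Y : F →L[𝕜] E) {n : WithTop ℕ∞} :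
    ContDiff 𝕜 n fun T => twist X Y (transfer X Y T) T :=
  (contDiff_twist X Y).comp ((contDiff_transfer X Y).prodMk contDiff_id)

namespace IsGeneralizedInverse

variable {X : E →L[𝕜] F} {Y : F →L[𝕜] E}

theorem transfer_twist (H : IsGeneralizedInverse X Y) (C : F →L[𝕜] F) (T : E →L[𝕜] F) :
    transfer X Y (twist X Y C T) = transfer X Y T := by
  ext y
  simp [H.apply_right]

theorem twist_twist (H : IsGeneralizedInverse X Y) (C D : F →L[𝕜] F) (T : E →L[𝕜] F) :
    twist X Y C (twist X Y D T) = twist X Y (C * D) T := by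
  ext x
  simp [H.apply_left]

theorem transfer_comp_self (H : IsGeneralizedInverse X Y) (T : E →L[𝕜] F) :
    transfer X Y T ∘L X = T ∘L Y ∘L X := by
  ext x
  simp [H.apply_left]

theorem twist_transfer_eq (H : IsGeneralizedInverse X Y) (T : E →L[𝕜] F) :
    twist X Y (transfer X Y T) T = T + (T - X) ∘L Y ∘L (T - X) ∘L kerProj X Y := by
  ext x
  simp only [twist_apply, transfer_apply, kerProj_apply, map_sub, ContinuousLinearMap.sub_comp,
    ContinuousLinearMap.comp_sub, add_apply, sub_apply, ContinuousLinearMap.comp_apply,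
    H.apply_left, sub_self, map_zero, sub_zero]
  abel

theorem hasFDerivAt_twist_transfer (H : IsGeneralizedInverse X Y) :
    HasFDerivAt (fun T => twist X Y (transfer X Y T) T)
      (ContinuousLinearMap.id 𝕜 (E →L[𝕜] F)) X := by
  have hsub : HasFDerivAt (fun T => T - X) (ContinuousLinearMap.id 𝕜 (E →L[𝕜] F)) X :=
    (hasFDerivAt_id X).sub_const X
  have hright := (hasFDerivAt_const Y X).clm_comp (hsub.clm_comp
    (hasFDerivAt_const (kerProj X Y) X))
  have hsq : HasFDerivAt (fun T => (T - X) ∘L Y ∘L (T - X) ∘L kerProj X Y)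
      (0 : (E →L[𝕜] F) →L[𝕜] (E →L[𝕜] F)) X :=
    (hsub.clm_comp hright).congr_fderiv (by ext T x; simp)
  simp only [H.twist_transfer_eq]
  exact ((hasFDerivAt_id X).fun_add hsq).congr_fderiv (add_zero _)

/-- The chart `T ↦ T Y X + (1 + (T - X) Y)⁻¹ T (1 - Y X)` around `X`. -/
noncomputable def chart [CompleteSpace F] (H : IsGeneralizedInverse X Y) :
    OpenPartialHomeomorph (E →L[𝕜] F) (E →L[𝕜] F) where
  toFun T := twist X Y (Ring.inverse (transfer X Y T)) T
  invFun T := twist X Y (transfer X Y T) T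
  source := {T | IsUnit (transfer X Y T)}
  target := {T | IsUnit (transfer X Y T)}
  map_source' T hT := by rwa [Set.mem_ofPred_eq, H.transfer_twist]
  map_target' T hT := by rwa [Set.mem_ofPred_eq, H.transfer_twist]
  left_inv' T hT := by
    rw [H.transfer_twist, H.twist_twist, Ring.mul_inverse_cancel _ hT, twist_one]
  right_inv' T hT := by
    rw [H.transfer_twist, H.twist_twist, Ring.inverse_mul_cancel _ hT, twist_one]
  open_source := isOpen_isUnit_transfer X Y
  open_target := isOpen_isUnit_transfer X Y
  continuousOn_toFun := (contDiffOn_twist_inverse_transfer X Y (n := 0)).continuousOn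
  continuousOn_invFun := (contDiff_twist_transfer X Y (n := 0)).continuous.continuousOn

theorem mem_chart_source [CompleteSpace F] (H : IsGeneralizedInverse X Y) :
    X ∈ H.chart.source := by
  simp [chart]

theorem chart_self [CompleteSpace F] (H : IsGeneralizedInverse X Y) : H.chart X = X := by
  simp [chart]

theorem areEquivalent_corner_chart [CompleteSpace F] (H : IsGeneralizedInverse X Y)
    {T : E →L[𝕜] F} (hT : T ∈ H.chart.source) :
    AreEquivalent (X + corner X Y (H.chart T)) T := by
  have ⟨A, hA⟩ := hT
  let W : E →L[𝕜] F := Ring.inverse (transfer X Y T) ∘L T ∘L kerProj X Y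
  have hWY : W ∘L Y = 0 := by
    ext y
    simp [W, H.apply_right]
  have hcorner : corner X Y (H.chart T) = corner X Y W := by
    ext x
    simp [chart, W, H.apply_left]
  have hTA : T = (A : F →L[𝕜] F) ∘L (X + W) := by
    have hAW : transfer X Y T ∘L W = T ∘L kerProj X Y := by
      ext x
      exact DFunLike.congr_fun (Ring.mul_inverse_cancel _ hT) (T (kerProj X Y x))
    rw [hA, ContinuousLinearMap.comp_add, H.transfer_comp_self, hAW]
    ext x
    simp
  obtain ⟨A', B, hAB⟩ := areEquivalent_add_corner hWY
  refine ⟨A'.trans (.ofUnit A), B, ?_⟩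
  rw [hcorner, hTA, hAB]
  rfl

end IsGeneralizedInverse

end Straightening

section RigidClass

variable {𝕜 : Type*} [RCLike 𝕜] {E F : Type*}
  [NormedAddCommGroup E] [NormedSpace 𝕜 E] [NormedAddCommGroup F] [NormedSpace 𝕜 F]

namespace IsGeneralizedInverse

variable {X : E →L[𝕜] F} {Y : F →L[𝕜] E}

theorem isDoubleSplitting (H : IsGeneralizedInverse X Y) : IsDoubleSplitting X :=
  ⟨H.isTopCompl_range_ker.symm.isClosed',
    ⟨Y.range, H.symm.isTopCompl_range_ker.isClosed, H.symm.isTopCompl_range_ker.isCompl.symm⟩,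
    ⟨Y.ker, Y.isClosed_ker, H.isTopCompl_range_ker.isCompl⟩⟩

theorem ker_corner (H : IsGeneralizedInverse X Y) : (corner X Y).ker = M X := by
  ext T
  constructor
  · intro hT x hx
    have hTx : kerProj Y X (T (kerProj X Y x)) = 0 := DFunLike.congr_fun hT x
    have hx' : X x = 0 := hx
    simp only [kerProj_apply, hx', map_zero, sub_zero, sub_eq_zero] at hTx
    exact ⟨Y (T x), hTx.symm⟩
  · intro hT
    ext x
    obtain ⟨z, hz⟩ := hT (kerProj X Y x) (by simp [H.apply_left])
    have hz' : T (kerProj X Y x) = X z := hz.symm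
    change kerProj Y X (T (kerProj X Y x)) = 0
    rw [hz']
    simp [H.apply_left]

end IsGeneralizedInverse

/-- A class of operators which admit generalized inverses, closed under equivalence, in which
enlarging the range and shrinking the kernel at the same time changes at most one of the two. This
is what `F_k`, `Φ_{m,n}`, `Φ_{m,∞}` and `Φ_{∞,n}` have in common. -/
structure IsRigidClass (S : Set (E →L[𝕜] F)) : Prop where
  exists_isGeneralizedInverse : ∀ X ∈ S, ∃ Y, IsGeneralizedInverse X Y
  mem_of_areEquivalent : ∀ T ∈ S, ∀ T', AreEquivalent T T' → T' ∈ S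
  ker_eq_or_range_eq : ∀ X ∈ S, ∀ Z ∈ S, Z.ker ≤ X.ker → X.range ≤ Z.range →
    Z.ker = X.ker ∨ Z.range = X.range

namespace IsRigidClass

variable {S : Set (E →L[𝕜] F)} {X : E →L[𝕜] F} {Y : F →L[𝕜] E}

theorem add_corner_mem_iff (hS : IsRigidClass S) (hX : X ∈ S) (H : IsGeneralizedInverse X Y)
    {T : E →L[𝕜] F} : X + corner X Y T ∈ S ↔ corner X Y T = 0 := by
  refine ⟨fun hmem => ?_, fun hzero => by rwa [hzero, add_zero]⟩
  rcases hS.ker_eq_or_range_eq X hX _ hmem (H.ker_add_corner_le T)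
    (H.range_le_range_add_corner T) with hker | hrange
  · exact H.corner_eq_zero_of_ker_add_corner_eq hker
  · exact H.corner_eq_zero_of_range_add_corner_eq hrange

theorem isImage_chart [CompleteSpace F] (hS : IsRigidClass S) (hX : X ∈ S)
    (H : IsGeneralizedInverse X Y) : H.chart.IsImage S (M X) := fun T hT => by
  have hequiv := H.areEquivalent_corner_chart hT
  calc H.chart T ∈ M X ↔ corner X Y (H.chart T) = 0 := by rw [← H.ker_corner]; rfl
    _ ↔ X + corner X Y (H.chart T) ∈ S := (hS.add_corner_mem_iff hX H).symm
    _ ↔ T ∈ S := ⟨fun h => hS.mem_of_areEquivalent _ h _ hequiv,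
      fun h => hS.mem_of_areEquivalent _ h _ hequiv.symm⟩

theorem isSmoothSubmanifoldTangentToM [CompleteSpace F] (hS : IsRigidClass S) :
    IsSmoothSubmanifoldTangentToM S := by
  refine ⟨fun X hX => ?_, fun X hX => ?_⟩ <;>
    obtain ⟨Y, H⟩ := hS.exists_isGeneralizedInverse X hX <;>
    have hM : IsTopCompl (corner X Y).range (M X) :=
      H.ker_corner ▸ ContinuousLinearMap.IsIdempotentElem.isTopCompl H.isIdempotentElem_corner
  · refine ⟨M X, (corner X Y).range, H.chart, hM.isClosed', hM.isClosed, hM.isCompl.symm,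
      H.mem_chart_source, contDiffOn_twist_inverse_transfer X Y,
      (contDiff_twist_transfer X Y).contDiffOn, ?_⟩
    rw [Set.inter_comm, (hS.isImage_chart hX H).image_eq, Set.inter_comm]
  · have hderiv : HasFDerivAt H.chart.symm
        (ContinuousLinearEquiv.refl 𝕜 (E →L[𝕜] F) : (E →L[𝕜] F) →L[𝕜] (E →L[𝕜] F))
        (H.chart X) := H.chart_self.symm ▸ H.hasFDerivAt_twist_transfer
    simpa using tangentVectors_eq_image_of_isImage hM.isClosed' (hS.isImage_chart hX H)
      (contDiff_twist_transfer X Y).contDiffOn H.mem_chart_source hX hderiv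

end IsRigidClass

end RigidClass

section RankLemmas

variable {K V : Type*} [DivisionRing K] [AddCommGroup V] [Module K V] {p q : Submodule K V}

theorem submodule_eq_of_le_of_rank_eq [FiniteDimensional K q] (hle : p ≤ q)
    (h : Module.rank K p = Module.rank K q) : p = q :=
  eq_of_le_of_finrank_eq hle (congrArg Cardinal.toNat h)

theorem submodule_eq_of_le_of_rank_quotient_eq [FiniteDimensional K (V ⧸ p)] (hle : p ≤ q)
    (h : Module.rank K (V ⧸ p) = Module.rank K (V ⧸ q)) : p = q := by
  have : FiniteDimensional K (V ⧸ q) := .of_surjective (factor hle) (factor_surjective hle)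
  have hinj : Function.Injective (factor hle) :=
    (LinearMap.injective_iff_surjective_of_finrank_eq_finrank (congrArg Cardinal.toNat h)).2
      (factor_surjective hle)
  refine le_antisymm hle fun x hx => ?_
  rw [← Quotient.mk_eq_zero] at hx ⊢
  exact hinj (by simpa using hx)

end RankLemmas

section Classes

variable {𝕜 : Type*} [RCLike 𝕜] {E F : Type*}
  [NormedAddCommGroup E] [NormedSpace 𝕜 E] [CompleteSpace E]
  [NormedAddCommGroup F] [NormedSpace 𝕜 F] [CompleteSpace F]

theorem IsDoubleSplitting.exists_isGeneralizedInverse {X : E →L[𝕜] F} (hX : IsDoubleSplitting X) :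
    ∃ Y, IsGeneralizedInverse X Y := by
  obtain ⟨-, ⟨R, hRc, hR⟩, N, hNc, hN⟩ := hX
  exact OperatorClasses.exists_isGeneralizedInverse hRc hR hNc hN

theorem IsDoubleSplitting.of_areEquivalent {T T' : E →L[𝕜] F} (hT : IsDoubleSplitting T)
    (h : AreEquivalent T T') : IsDoubleSplitting T' := by
  obtain ⟨Y, H⟩ := hT.exists_isGeneralizedInverse
  obtain ⟨Y', H'⟩ := h.exists_isGeneralizedInverse H
  exact H'.isDoubleSplitting

theorem isRigidClass_rankClass (k : ℕ) : IsRigidClass (rankClass 𝕜 E F k) where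
  exists_isGeneralizedInverse X hX := by
    have : FiniteDimensional 𝕜 X.range := .of_rank_eq_nat hX
    have : FiniteDimensional 𝕜 (E ⧸ X.ker) := X.toLinearMap.quotKerEquivRange.symm.finiteDimensional
    obtain ⟨R, hRc, hR⟩ :=
      (ClosedComplemented.of_finiteDimensional_quotient X.isClosed_ker).exists_isClosed_isCompl
    obtain ⟨N, hNc, hN⟩ :=
      (ClosedComplemented.of_finiteDimensional X.range).exists_isClosed_isCompl
    exact exists_isGeneralizedInverse hRc hR hNc hN
  mem_of_areEquivalent _ hT _ h := h.rank_range_eq.symm.trans hT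
  ker_eq_or_range_eq X hX Z hZ _ hrange := by
    have : FiniteDimensional 𝕜 Z.range := .of_rank_eq_nat hZ
    exact .inr (submodule_eq_of_le_of_rank_eq hrange (hX.trans hZ.symm)).symm

theorem isRigidClass_PhiFinFin (m n : ℕ) : IsRigidClass (PhiFinFin 𝕜 E F m n) where
  exists_isGeneralizedInverse X hX := by
    have : FiniteDimensional 𝕜 X.ker := .of_rank_eq_nat hX.1
    have : FiniteDimensional 𝕜 (F ⧸ X.range) := .of_rank_eq_nat hX.2
    obtain ⟨R, hRc, hR⟩ :=
      (ClosedComplemented.of_finiteDimensional X.ker).exists_isClosed_isCompl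
    obtain ⟨N, hN⟩ := Submodule.exists_isCompl X.range
    have : FiniteDimensional 𝕜 N := (quotientEquivOfIsCompl _ _ hN).finiteDimensional
    exact exists_isGeneralizedInverse hRc hR N.closed_of_finiteDimensional hN
  mem_of_areEquivalent _ hT _ h :=
    ⟨h.rank_ker_eq.symm.trans hT.1, h.rank_quotient_range_eq.symm.trans hT.2⟩
  ker_eq_or_range_eq X hX Z hZ hker _ := by
    have : FiniteDimensional 𝕜 X.ker := .of_rank_eq_nat hX.1
    exact .inl (submodule_eq_of_le_of_rank_eq hker (hZ.1.trans hX.1.symm))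

theorem isRigidClass_PhiFinInf (m : ℕ) : IsRigidClass (PhiFinInf 𝕜 E F m) where
  exists_isGeneralizedInverse _ hX := hX.2.1.exists_isGeneralizedInverse
  mem_of_areEquivalent T hT T' h := by
    obtain ⟨-, hsplit, hker, hcoker⟩ := hT
    have hsplit' := hsplit.of_areEquivalent h
    have hker' : Module.rank 𝕜 T'.ker = m := h.rank_ker_eq.symm.trans hker
    have hcoker' : ¬ FiniteDimensional 𝕜 (F ⧸ T'.range) := fun _ =>
      hcoker (Module.rank_lt_aleph0_iff.1 (h.rank_quotient_range_eq ▸ Module.rank_lt_aleph0 𝕜 _))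
    exact ⟨⟨hsplit'.1, .inl (.of_rank_eq_nat hker')⟩, hsplit', hker', hcoker'⟩
  ker_eq_or_range_eq X hX Z hZ hker _ := by
    obtain ⟨-, -, hkerX, -⟩ := hX
    obtain ⟨-, -, hkerZ, -⟩ := hZ
    have : FiniteDimensional 𝕜 X.ker := .of_rank_eq_nat hkerX
    exact .inl (submodule_eq_of_le_of_rank_eq hker (hkerZ.trans hkerX.symm))

theorem isRigidClass_PhiInfFin (n : ℕ) : IsRigidClass (PhiInfFin 𝕜 E F n) where
  exists_isGeneralizedInverse _ hX := hX.2.1.exists_isGeneralizedInverse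
  mem_of_areEquivalent T hT T' h := by
    obtain ⟨-, hsplit, hker, hcoker⟩ := hT
    have hsplit' := hsplit.of_areEquivalent h
    have hcoker' : Module.rank 𝕜 (F ⧸ T'.range) = n := h.rank_quotient_range_eq.symm.trans hcoker
    have hker' : ¬ FiniteDimensional 𝕜 T'.ker := fun _ =>
      hker (Module.rank_lt_aleph0_iff.1 (h.rank_ker_eq ▸ Module.rank_lt_aleph0 𝕜 _))
    exact ⟨⟨hsplit'.1, .inr (.of_rank_eq_nat hcoker')⟩, hsplit', hker', hcoker'⟩
  ker_eq_or_range_eq X hX Z hZ _ hrange := by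
    obtain ⟨-, -, -, hcokerX⟩ := hX
    obtain ⟨-, -, -, hcokerZ⟩ := hZ
    have : FiniteDimensional 𝕜 (F ⧸ X.range) := .of_rank_eq_nat hcokerX
    exact .inr (submodule_eq_of_le_of_rank_quotient_eq hrange (hcokerX.trans hcokerZ.symm)).symm

end Classes

end OperatorClasses

theorem theorem4p2 {𝕜 : Type*} [RCLike 𝕜]
    {E F : Type*} [NormedAddCommGroup E] [NormedSpace 𝕜 E] [CompleteSpace E]
    [NormedAddCommGroup F] [NormedSpace 𝕜 F] [CompleteSpace F] :
    (∀ k : ℕ, OperatorClasses.IsSmoothSubmanifoldTangentToM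
      (OperatorClasses.rankClass 𝕜 E F k)) ∧
    (∀ m n : ℕ, OperatorClasses.IsSmoothSubmanifoldTangentToM
      (OperatorClasses.PhiFinFin 𝕜 E F m n)) ∧
    (∀ m : ℕ, OperatorClasses.IsSmoothSubmanifoldTangentToM
      (OperatorClasses.PhiFinInf 𝕜 E F m)) ∧
    (∀ n : ℕ, OperatorClasses.IsSmoothSubmanifoldTangentToM
      (OperatorClasses.PhiInfFin 𝕜 E F n)) :=
  ⟨fun k => (OperatorClasses.isRigidClass_rankClass k).isSmoothSubmanifoldTangentToM,
    fun m n => (OperatorClasses.isRigidClass_PhiFinFin m n).isSmoothSubmanifoldTangentToM,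
    fun m => (OperatorClasses.isRigidClass_PhiFinInf m).isSmoothSubmanifoldTangentToM,
    fun n => (OperatorClasses.isRigidClass_PhiInfFin n).isSmoothSubmanifoldTangentToM⟩
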